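/- Let $d\ge 1$, $N\ge 0$, $M\ge 1$ be integers and $\mathcal H=\mathbb C^d$; write $\psi=|\psi\rangle\langle\psi|$ for the projector onto a unit vector $|\psi\rangle\in\mathcal H$, and let $d\psi$ be the probability measure on pure states induced by the Haar probability measure on $U(d)$. An $N\to M$ cloning machine is a completely positive linear map $\mathcal L:\mathcal B(\mathcal H^{\otimes N})\to\mathcal B(\mathcal H^{\otimes M})$ with $\operatorname{tr}\mathcal L(\psi^{\otimes N})=1$ for every unit vector $|\psi\rangle$. It is called universal if, for every $|\psi\rangle$, the reduced states $\operatorname{tr}_{\bar k}\mathcal L(\psi^{\otimes N})$ of its clones $k=1,\dots,M$ all coincide ($\operatorname{tr}_{\bar k}$ is the trace over all factors but the $k$-th), and the fidelity $\langle\psi|\operatorname{tr}_{\bar k}\mathcal L(\psi^{\otimes N})|\psi\rangle$ does not depend on $|\psi\rangle$. Its average single-copy fidelity is $$\mathcal F(\mathcal L)=\sum_{k=1}^M\int\frac1M\,\langle\psi|\operatorname{tr}_{\bar k}\mathcal L(\psi^{\otimes N})|\psi\rangle\,d\psi .$$ An adversary intercepts an $N$-photon challenge $|\psi\rangle^{\otimes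 N}$, applies an $N\to M$ universal cloning machine $\mathcal L$, and returns $R^{\otimes M}\mathcal L(\psi^{\otimes N})R^{\dagger\otimes M}$, where $R\in U(d)$ is the reflection matrix of the PUF (physical unclonable function, the device being authenticated). The verifier tests a returned copy with the projector onto the valid response $R|\psi\rangle$. The single-copy false-accept probability (for the $k$-th copy) is $$\mathcal P_{\mathrm{accept}}=\int\langle R\psi|\operatorname{tr}_{\bar k}\!\big(R^{\otimes M}\mathcal L(\psi^{\otimes N})R^{\dagger\otimes M}\big)|R\psi\rangle\,d\psi .$$ Then for every $R\in U(d)$, every universal $\mathcal L$ and every $k$, $$\mathcal P_{\mathrm{accept}}=\mathcal F(\mathcal L)\le\frac{M-N+N(M+d)}{M(N+d)} .$$ Moreover, if $N\le M$, the right-hand side is the optimal fidelity: it is the maximum of $\mathcal F(\mathcal L)$ over all universal $N\to M$ cloning machines $\mathcal L$. -/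

import Mathlib

open MeasureTheory
open scoped Matrix Matrix.Norms.L2Operator MatrixOrder CStarAlgebra ComplexOrder

noncomputable section

namespace PUFCloning

/-! The one-particle space is `ℂ^d`, in an orthonormal basis indexed by `Fin d`; its `n`-fold tensor
power has the product basis indexed by `Fin n → Fin d`. Operators are matrices in these bases. -/

/-- Operators on the `n`-fold tensor power of `ℂ^d`. -/
abbrev Op (d n : ℕ) : Type := Matrix (Fin n → Fin d) (Fin n → Fin d) ℂ

/-- `ψ` is a unit vector of `ℂ^d` for the standard Hermitian inner product. -/
def IsPure {d : ℕ} (ψ : Fin d → ℂ) : Prop := star ψ ⬝ᵥ ψ = 1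

/-- The vector `ψ ⊗ ⋯ ⊗ ψ` (`n` factors). -/
def tensorVec {d : ℕ} (n : ℕ) (ψ : Fin d → ℂ) : (Fin n → Fin d) → ℂ :=
  fun i => ∏ a, ψ (i a)

/-- The rank-one operator `|ψ⟩⟨ψ| ⊗ ⋯ ⊗ |ψ⟩⟨ψ|` (`n` factors). -/
def pureInput {d : ℕ} (n : ℕ) (ψ : Fin d → ℂ) : Op d n :=
  Matrix.vecMulVec (tensorVec n ψ) (star (tensorVec n ψ))

/-- The collective operator `A ⊗ ⋯ ⊗ A` (`n` factors). -/
def tensorOp {d : ℕ} (n : ℕ) (A : Matrix (Fin d) (Fin d) ℂ) : Op d n :=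
  Matrix.of fun i j => ∏ a, A (i a) (j a)

/-- The partial trace over all tensor factors except the `k`-th one. -/
def reducedState {d n : ℕ} (k : Fin n) (ρ : Op d n) : Matrix (Fin d) (Fin d) ℂ :=
  Matrix.of fun x y => ∑ i : Fin n → Fin d with i k = x, ρ i (Function.update i k y)

/-- The probability `⟨χ|σ|χ⟩` of projecting `σ` onto the unit vector `χ`
(a real number when `σ` is a density operator). -/
def overlap {d : ℕ} (χ : Fin d → ℂ) (σ : Matrix (Fin d) (Fin d) ℂ) : ℝ :=
  (star χ ⬝ᵥ (σ *ᵥ χ)).re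

/-- An `N → M` cloning machine: a completely positive map from operators on the `N`-fold to operators
on the `M`-fold tensor power that sends `N` identical pure originals to states (trace one). -/
structure CloningMachine (d N M : ℕ) where
  /-- the underlying completely positive map -/
  map : Op d N →CP Op d M
  trace_map : ∀ ψ : Fin d → ℂ, IsPure ψ → (map (pureInput N ψ)).trace = 1

instance (d : ℕ) : MeasurableSpace (Matrix.unitaryGroup (Fin d) ℂ) := borel _

instance (d : ℕ) : BorelSpace (Matrix.unitaryGroup (Fin d) ℂ) := ⟨rfl⟩

instance (d : ℕ) : CompactSpace (Matrix.unitaryGroup (Fin d) ℂ) := by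
  apply isCompact_iff_compactSpace.mp
  have hK : IsCompact (Set.pi Set.univ fun _ : Fin d => Set.pi Set.univ fun _ : Fin d =>
      Metric.closedBall (0 : ℂ) 1) :=
    isCompact_univ_pi fun _ => isCompact_univ_pi fun _ => isCompact_closedBall 0 1
  refine IsCompact.of_isClosed_subset (X := Matrix (Fin d) (Fin d) ℂ) hK ?_ ?_
  · have : ((Matrix.unitaryGroup (Fin d) ℂ : Submonoid _) : Set (Matrix (Fin d) (Fin d) ℂ)) =
        {U | star U * U = 1} ∩ {U | U * star U = 1} := by
      ext U; exact Unitary.mem_iff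
    rw [this]
    exact (isClosed_eq (by fun_prop) continuous_const).inter
      (isClosed_eq (by fun_prop) continuous_const)
  · intro U hU i _ j _
    simpa using entry_norm_bound_of_unitary hU i j

/-- The Haar probability measure on the unitary group `U(d)`. -/
def haarUnitary (d : ℕ) : Measure (Matrix.unitaryGroup (Fin d) ℂ) :=
  Measure.haarMeasure ⊤

/-- The average of `f` over pure states, for the measure induced by the Haar probability measure on
`U(d)` through the orbit map `U ↦ U|0⟩`. -/
def pureAverage {d : ℕ} [NeZero d] (f : (Fin d → ℂ) → ℝ) : ℝ :=
  ∫ U, f (U.1 *ᵥ Pi.single 0 1) ∂haarUnitary d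

namespace CloningMachine

variable {d N M : ℕ}

/-- The reduced state of the `k`-th clone on input `ψ ⊗ ⋯ ⊗ ψ`. -/
def clone (L : CloningMachine d N M) (k : Fin M) (ψ : Fin d → ℂ) : Matrix (Fin d) (Fin d) ℂ :=
  reducedState k (L.map (pureInput N ψ))

/-- A universal (symmetric) cloning machine: all clones are in the same state, and the quality of the
clones does not depend on the cloned pure state. -/
structure IsUniversal (L : CloningMachine d N M) : Prop where
  same_clones : ∀ ψ : Fin d → ℂ, IsPure ψ → ∀ j k : Fin M, L.clone j ψ = L.clone k ψ
  state_independent : ∀ ψ φ : Fin d → ℂ, IsPure ψ → IsPure φ → ∀ k : Fin M,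
    overlap ψ (L.clone k ψ) = overlap φ (L.clone k φ)

/-- The average single-copy fidelity of a cloning machine. -/
def fidelity [NeZero d] (L : CloningMachine d N M) : ℝ :=
  ∑ k : Fin M, pureAverage fun ψ => (1 / (M : ℝ)) * overlap ψ (L.clone k ψ)

/-- The state `R^{⊗M} L(ψ^{⊗N}) (R^{⊗M})†` that the verifier receives when the clones of the
challenge `ψ` have been reflected by a device with reflection matrix `R`. -/
def response (R : Matrix (Fin d) (Fin d) ℂ) (L : CloningMachine d N M) (ψ : Fin d → ℂ) : Op d M :=
  tensorOp M R * L.map (pureInput N ψ) * (tensorOp M R)ᴴ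

/-- The probability, averaged over the random challenge `ψ`, that the `k`-th returned copy passes the
verifier's projective test onto the valid response `R ψ`. -/
def falseAccept [NeZero d] (R : Matrix (Fin d) (Fin d) ℂ) (L : CloningMachine d N M)
    (k : Fin M) : ℝ :=
  pureAverage fun ψ => overlap (R *ᵥ ψ) (reducedState k (L.response R ψ))

end CloningMachine

end PUFCloning

end

/-!
Fix a basis, so that a tensor of rank `n` over `ℂ^d` pairs with `ψ^{⊗n}` to a homogeneous polynomial
of degree `n` in the coordinates of `ψ`. The proof works in the polynomial ring with the Fischer
inner product `⟨f, g⟩ = ∑ α, α! * conj (f_α) * g_α`, for which multiplication by `X_a` and `∂/∂X_a` are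
adjoint (`fischer_X_mul_left`): this is the bosonic Fock space.
On homogeneous polynomials of degree `n`, `∑ x, ‖∂_x f‖² = n ‖f‖²` and `∑ x, ‖X_x f‖² = (n + d) ‖f‖²`.

Upper bound. For a universal machine the fidelity is the same number `F` for all pure states and all
clones, so `F` is the false-accept probability, the reflection by `R` dropping out by unitarity
(`overlap_response`), and no Haar integral is left to compute. An identity
`∑ f_i(ψ) * conj (g_i(ψ)) = c * ‖ψ‖^{2n}` for all `ψ` forces
`∑ ⟨g_i, f_i⟩ = c * d (d+1) ⋯ (d+n-1)` (`re_sum_fischer_of_const`), because the characters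
`ψ ↦ ψ^α * conj (ψ)^β` are linearly independent. By Choi's theorem (`exists_kraus`) the output on
`ψ^{⊗N}` is `∑ r, |V_r(ψ)⟩⟨V_r(ψ)|` with components `V_{r,m}` homogeneous of degree `N`. Trace
normalisation gives `∑ ‖V_{r,m}‖² = d (d+1) ⋯ (d+N-1)`. Commuting `∂` past `X` in the fidelity of
the `k`-th clone gives `F * d (d+1) ⋯ (d+N)` as the sum of `∑ ‖V_{r,m}‖²` and the squared norm of the
contraction of the gradient `∂_y V_{r,m}` in the indices `y` and `m k`. Summed over the `M` clones,
these contractions are at most `M + d - 1` times the squared norm of the gradient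
(`sum_contract_le`), which is `N * ∑ ‖V_{r,m}‖²`. Together,
`M (N + d) F ≤ M + N (M + d - 1)`.

Attainment. The optimal machine tensors `ψ^{⊗N}` with the maximally mixed state on `M - N` factors
and compresses to the symmetric subspace. Its Kraus vectors are the symmetric tensors
`m ↦ ⟨X_m, (∑ x, ψ_x X_x)^N X_r⟩`, so its clones coincide, and its trace and fidelity follow
from the norm formulas above and the commutation relation of `∑ x, ψ_x X_x` with its adjoint
(`overlap_optimalCloner`).
-/

noncomputable section

namespace PUFCloning

open MvPolynomial

/-! ### The Fischer inner product -/

section Fischer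

variable {σ ι : Type*} [Fintype σ]

/-- The factorial `α! = ∏ a, (α a)!` of a multi-index. -/
def multiFactorial (α : σ →₀ ℕ) : ℝ := ∏ a, ((α a).factorial : ℝ)

/-- The Fischer inner product `∑ α, α! * conj (f_α) * g_α` of two polynomials, conjugate-linear
in the first argument. -/
def fischer (f g : MvPolynomial σ ℂ) : ℂ :=
  ∑ α ∈ f.support, (multiFactorial α : ℂ) * star (coeff α f) * coeff α g

theorem multiFactorial_nonneg (α : σ →₀ ℕ) : 0 ≤ multiFactorial α :=
  Finset.prod_nonneg fun _ _ => Nat.cast_nonneg _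

theorem multiFactorial_add_single (α : σ →₀ ℕ) (a : σ) :
    multiFactorial (α + Finsupp.single a 1) = multiFactorial α * (α a + 1) := by
  classical
  unfold multiFactorial
  rw [← Finset.mul_prod_erase _ _ (Finset.mem_univ a),
    ← Finset.mul_prod_erase (a := a) Finset.univ (fun b => ((α b).factorial : ℝ))
      (Finset.mem_univ a)]
  have : ∏ x ∈ Finset.univ.erase a, (((α + Finsupp.single a 1 : σ →₀ ℕ) x).factorial : ℝ) =
      ∏ x ∈ Finset.univ.erase a, ((α x).factorial : ℝ) := by
    refine Finset.prod_congr rfl fun x hx => ?_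
    rw [Finsupp.add_apply, Finsupp.single_eq_of_ne (Finset.ne_of_mem_erase hx), add_zero]
  rw [this, Finsupp.add_apply, Finsupp.single_eq_same, Nat.factorial_succ]
  push_cast
  ring

theorem fischer_eq_sum {f : MvPolynomial σ ℂ} {s : Finset (σ →₀ ℕ)} (hs : f.support ⊆ s)
    (g : MvPolynomial σ ℂ) :
    fischer f g = ∑ α ∈ s, (multiFactorial α : ℂ) * star (coeff α f) * coeff α g := by
  refine Finset.sum_subset hs fun α _ hα => ?_
  rw [notMem_support_iff.mp hα, star_zero, mul_zero, zero_mul]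

theorem fischer_comm (f g : MvPolynomial σ ℂ) : fischer g f = star (fischer f g) := by
  classical
  rw [fischer_eq_sum (s := g.support ∪ f.support) Finset.subset_union_left,
    fischer_eq_sum (s := g.support ∪ f.support) Finset.subset_union_right, star_sum]
  refine Finset.sum_congr rfl fun α _ => ?_
  simp only [star_mul', Complex.star_def, Complex.conj_ofReal, Complex.conj_conj]
  ring

theorem fischer_add_right (f g h : MvPolynomial σ ℂ) :
    fischer f (g + h) = fischer f g + fischer f h := by
  simp only [fischer, coeff_add, mul_add, Finset.sum_add_distrib]

theorem fischer_smul_right (c : ℂ) (f g : MvPolynomial σ ℂ) :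
    fischer f (c • g) = c * fischer f g := by
  simp only [fischer, coeff_smul, smul_eq_mul, Finset.mul_sum]
  exact Finset.sum_congr rfl fun _ _ => by ring

/-- The Fischer inner product as a linear map in its second argument. -/
def fischerRight (f : MvPolynomial σ ℂ) : MvPolynomial σ ℂ →ₗ[ℂ] ℂ where
  toFun := fischer f
  map_add' := fischer_add_right f
  map_smul' := fun c g => fischer_smul_right c f g

theorem fischer_sum_right (s : Finset ι) (f : MvPolynomial σ ℂ) (g : ι → MvPolynomial σ ℂ) :
    fischer f (∑ i ∈ s, g i) = ∑ i ∈ s, fischer f (g i) :=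
  map_sum (fischerRight f) g s

theorem fischer_sum_left (s : Finset ι) (f : ι → MvPolynomial σ ℂ) (g : MvPolynomial σ ℂ) :
    fischer (∑ i ∈ s, f i) g = ∑ i ∈ s, fischer (f i) g := by
  rw [fischer_comm, fischer_sum_right, star_sum]
  exact Finset.sum_congr rfl fun i _ => (fischer_comm _ _).symm

theorem fischer_smul_left (c : ℂ) (f g : MvPolynomial σ ℂ) :
    fischer (c • f) g = star c * fischer f g := by
  rw [fischer_comm, fischer_smul_right, star_mul', ← fischer_comm]

/-- Multiplication by a variable is adjoint to differentiation in that variable. -/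
theorem fischer_X_mul_left (a : σ) (f g : MvPolynomial σ ℂ) :
    fischer (X a * f) g = fischer f (pderiv a g) := by
  unfold fischer
  rw [support_X_mul, Finset.sum_map]
  refine Finset.sum_congr rfl fun α _ => ?_
  rw [addLeftEmbedding_apply, coeff_X_mul, coeff_pderiv, add_comm, multiFactorial_add_single]
  push_cast
  ring

theorem fischer_X_mul_right (a : σ) (f g : MvPolynomial σ ℂ) :
    fischer f (X a * g) = fischer (pderiv a f) g := by
  rw [fischer_comm, fischer_X_mul_left, ← fischer_comm]

theorem fischer_self (f : MvPolynomial σ ℂ) {s : Finset (σ →₀ ℕ)} (hs : f.support ⊆ s) :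
    fischer f f = ((∑ α ∈ s, multiFactorial α * ‖coeff α f‖ ^ 2 : ℝ) : ℂ) := by
  rw [fischer_eq_sum hs]
  push_cast
  refine Finset.sum_congr rfl fun α _ => ?_
  rw [mul_assoc, Complex.star_def, Complex.conj_mul']

/-! ### Polynomials in the coordinates of a vector and their conjugates -/

/-- The character `ψ ↦ ∏ a, ψ_a ^ (α a) * conj (ψ_a) ^ (β a)` of the multiplicative monoid
`σ → ℂ`. -/
def conjMonomial (p : (σ →₀ ℕ) × (σ →₀ ℕ)) : (σ → ℂ) →* ℂ where
  toFun ψ := ∏ a, ψ a ^ p.1 a * star (ψ a) ^ p.2 a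
  map_one' := by simp
  map_mul' ψ φ := by
    rw [← Finset.prod_mul_distrib]
    refine Finset.prod_congr rfl fun a _ => ?_
    rw [Pi.mul_apply, star_mul', mul_pow, mul_pow]
    ring

theorem exponents_eq_of_forall {p q p' q' : ℕ}
    (h : ∀ z : ℂ, z ^ p * star z ^ q = z ^ p' * star z ^ q') : p = p' ∧ q = q' := by
  -- at `z = 2` the identity forces the total degrees to agree
  have h2 : p + q = p' + q' := by
    have := h 2
    rw [show star (2 : ℂ) = 2 from Complex.conj_ofNat 2, ← pow_add, ← pow_add] at this
    exact Nat.pow_right_injective le_rfl (by exact_mod_cast this)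
  -- at `z = exp i` the identity forces `p - q` and `p' - q'` to agree, as `π` is irrational
  have h1 := h (Complex.exp Complex.I)
  rw [Complex.star_def, ← Complex.exp_conj, Complex.conj_I, ← Complex.exp_nat_mul,
    ← Complex.exp_nat_mul, ← Complex.exp_nat_mul, ← Complex.exp_nat_mul, ← Complex.exp_add,
    ← Complex.exp_add, Complex.exp_eq_exp_iff_exists_int] at h1
  obtain ⟨n, hn⟩ := h1
  have h3 : ((p : ℝ) - q) = (p' - q') + n * (2 * Real.pi) := by
    have := congrArg Complex.im hn
    simpa [sub_eq_add_neg] using this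
  have hn0 : n = 0 := by
    by_contra hne
    have hne' : (n : ℝ) ≠ 0 := by exact_mod_cast hne
    refine irrational_pi ⟨((p : ℚ) - q - (p' - q')) / (2 * n), ?_⟩
    push_cast
    field_simp
    linarith
  rw [hn0] at h3
  have h4 : ((p : ℤ) - q) = p' - q' := by
    have : ((p : ℝ) - q) = (p' - q') := by simpa using h3
    exact_mod_cast this
  omega

theorem conjMonomial_injective :
    Function.Injective (conjMonomial : (σ →₀ ℕ) × (σ →₀ ℕ) → ((σ → ℂ) →* ℂ)) := by
  classical
  intro p q hpq
  have key : ∀ a, p.1 a = q.1 a ∧ p.2 a = q.2 a := by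
    intro a
    refine exponents_eq_of_forall fun z => ?_
    have hz : ∀ p : (σ →₀ ℕ) × (σ →₀ ℕ),
        conjMonomial p (Function.update 1 a z) = z ^ p.1 a * star z ^ p.2 a := by
      intro p
      refine (Finset.prod_eq_single a (fun b _ hb => ?_) (by simp)).trans ?_
      · rw [Function.update_of_ne hb]; simp
      · rw [Function.update_self]
    rw [← hz p, ← hz q, hpq]
  exact Prod.ext (Finsupp.ext fun a => (key a).1) (Finsupp.ext fun a => (key a).2)

/-- An identity between sums of products `f(ψ) * conj (g(ψ))` at all vectors `ψ` is an identity of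
coefficients, so it carries over to Fischer inner products. -/
theorem sum_fischer_eq_zero (s : Finset ι) (f g : ι → MvPolynomial σ ℂ)
    (h : ∀ ψ : σ → ℂ, ∑ i ∈ s, eval ψ (f i) * star (eval ψ (g i)) = 0) :
    ∑ i ∈ s, fischer (g i) (f i) = 0 := by
  classical
  let D : Finset (σ →₀ ℕ) := s.biUnion fun i => (f i).support ∪ (g i).support
  have hf : ∀ i ∈ s, (f i).support ⊆ D := fun i hi =>
    Finset.subset_union_left.trans
      (Finset.subset_biUnion_of_mem (fun i => (f i).support ∪ (g i).support) hi)
  have hg : ∀ i ∈ s, (g i).support ⊆ D := fun i hi =>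
    Finset.subset_union_right.trans
      (Finset.subset_biUnion_of_mem (fun i => (f i).support ∪ (g i).support) hi)
  have heval : ∀ (q : MvPolynomial σ ℂ), q.support ⊆ D → ∀ ψ : σ → ℂ,
      eval ψ q = ∑ α ∈ D, coeff α q * ∏ a, ψ a ^ α a := by
    intro q hq ψ
    rw [eval_eq']
    refine Finset.sum_subset hq fun α _ hα => ?_
    rw [notMem_support_iff.mp hα, zero_mul]
  -- the coefficient of `ψ ^ p.1 * conj ψ ^ p.2`; linear independence of characters kills it
  let c : (σ →₀ ℕ) × (σ →₀ ℕ) → ℂ := fun p =>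
    ∑ i ∈ s, coeff p.1 (f i) * star (coeff p.2 (g i))
  have hli := (linearIndependent_monoidHom (σ → ℂ) ℂ).comp _ (conjMonomial_injective (σ := σ))
  have hc : ∀ p ∈ D ×ˢ D, c p = 0 := by
    refine linearIndependent_iff'.mp hli (D ×ˢ D) c ?_
    funext ψ
    rw [Pi.zero_apply, ← h ψ, Finset.sum_apply]
    have : ∀ i ∈ s, eval ψ (f i) * star (eval ψ (g i)) = ∑ p ∈ D ×ˢ D,
        coeff p.1 (f i) * star (coeff p.2 (g i)) * conjMonomial p ψ := by
      intro i hi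
      rw [heval _ (hf i hi), heval _ (hg i hi), star_sum, Finset.sum_mul_sum,
        Finset.sum_product]
      refine Finset.sum_congr rfl fun α _ => Finset.sum_congr rfl fun β _ => ?_
      simp only [conjMonomial, MonoidHom.coe_mk, OneHom.coe_mk, Finset.prod_mul_distrib, star_mul',
        star_prod, star_pow]
      ring
    rw [Finset.sum_congr rfl this, Finset.sum_comm]
    refine Finset.sum_congr rfl fun p _ => ?_
    simp only [Pi.smul_apply, Function.comp_apply, smul_eq_mul, c, Finset.sum_mul]
  rw [Finset.sum_congr rfl fun i hi => fischer_eq_sum (hg i hi) (f i), Finset.sum_comm]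
  refine Finset.sum_eq_zero fun α hα => ?_
  have := hc (α, α) (Finset.mk_mem_product hα hα)
  rw [Finset.sum_congr rfl fun i _ => show _ = (multiFactorial α : ℂ) *
    (coeff α (f i) * star (coeff α (g i))) by ring, ← Finset.mul_sum]
  rw [show ∑ i ∈ s, coeff α (f i) * star (coeff α (g i)) = 0 from this, mul_zero]

end Fischer

/-! ### Homogeneous polynomials under the Fischer inner product -/

section Homogeneous

variable {d n : ℕ}

theorem sum_fischer_pderiv {f : MvPolynomial (Fin d) ℂ} (hf : f.IsHomogeneous n) :
    ∑ x, fischer (pderiv x f) (pderiv x f) = n * fischer f f := by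
  rw [Finset.sum_congr rfl fun x _ => (fischer_X_mul_right x f (pderiv x f)).symm,
    ← fischer_sum_right, hf.sum_X_mul_pderiv, ← Nat.cast_smul_eq_nsmul ℂ, fischer_smul_right]

theorem sum_fischer_X_mul {f : MvPolynomial (Fin d) ℂ} (hf : f.IsHomogeneous n) :
    ∑ x, fischer (X x * f) (X x * f) = (n + d) * fischer f f := by
  have h : ∑ x, pderiv x (X x * f) = ((d : ℂ) + n) • f := by
    simp only [pderiv_mul, pderiv_X_self, one_mul, Finset.sum_add_distrib, hf.sum_X_mul_pderiv]
    simp only [Finset.sum_const, Finset.card_univ, Fintype.card_fin]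
    rw [← Nat.cast_smul_eq_nsmul ℂ, ← Nat.cast_smul_eq_nsmul ℂ, add_smul]
  rw [Finset.sum_congr rfl fun x _ => fischer_X_mul_left x f (X x * f), ← fischer_sum_right, h,
    fischer_smul_right, add_comm (d : ℂ)]

/-- The monomial `∏ a, X (i a)` attached to a basis vector of the tensor power. -/
def tensorMonomial (i : Fin n → Fin d) : MvPolynomial (Fin d) ℂ := ∏ a, X (i a)

theorem tensorMonomial_isHomogeneous (i : Fin n → Fin d) : (tensorMonomial i).IsHomogeneous n := by
  have := IsHomogeneous.prod Finset.univ (fun a => (X (i a) : MvPolynomial (Fin d) ℂ))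
    (fun _ => 1) fun a _ => isHomogeneous_X ℂ (i a)
  simpa [tensorMonomial] using this

theorem eval_tensorMonomial (ψ : Fin d → ℂ) (i : Fin n → Fin d) :
    eval ψ (tensorMonomial i) = tensorVec n ψ i := by
  simp [tensorMonomial, tensorVec]

theorem tensorMonomial_cons (x : Fin d) (i : Fin n → Fin d) :
    tensorMonomial (Fin.cons x i) = X x * tensorMonomial i := by
  simp [tensorMonomial, Fin.prod_univ_succ]

theorem tensorMonomial_insertNth (k : Fin (n + 1)) (x : Fin d) (i : Fin n → Fin d) :
    tensorMonomial (k.insertNth (α := fun _ => Fin d) x i) = X x * tensorMonomial i := by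
  simp [tensorMonomial, Fin.prod_univ_succAbove _ k]

theorem sum_fin_succ_pi {E : Type*} [AddCommMonoid E] (F : (Fin (n + 1) → Fin d) → E) :
    ∑ i, F i = ∑ i : Fin n → Fin d, ∑ x, F (Fin.cons x i) := by
  rw [← (Fin.consEquiv fun _ => Fin d).sum_comp, Fintype.sum_prod_type_right]
  rfl

/-- The squared norms of `h * X_r`, summed over all tensor basis vectors `r` of length `s`. -/
theorem sum_fischer_mul_tensorMonomial {h : MvPolynomial (Fin d) ℂ} (hh : h.IsHomogeneous n)
    (s : ℕ) :
    ∑ r : Fin s → Fin d, fischer (h * tensorMonomial r) (h * tensorMonomial r) =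
      ((n + d).ascFactorial s : ℂ) * fischer h h := by
  induction s with
  | zero => simp [tensorMonomial]
  | succ s ih =>
    have : ∀ r : Fin s → Fin d, ∑ x, fischer (h * tensorMonomial (Fin.cons x r))
        (h * tensorMonomial (Fin.cons x r)) =
        (((n + s : ℕ) : ℂ) + d) * fischer (h * tensorMonomial r) (h * tensorMonomial r) := by
      intro r
      rw [← sum_fischer_X_mul (hh.mul (tensorMonomial_isHomogeneous r))]
      refine Finset.sum_congr rfl fun x _ => ?_
      rw [tensorMonomial_cons, mul_left_comm]
    rw [sum_fin_succ_pi, Finset.sum_congr rfl fun r _ => this r, ← Finset.mul_sum, ih,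
      Nat.ascFactorial_succ]
    push_cast
    ring

theorem fischer_one_one : fischer (1 : MvPolynomial (Fin d) ℂ) 1 = 1 := by
  rw [fischer_eq_sum (s := {0})]
  · simp [multiFactorial]
  · intro α hα
    simp only [mem_support_iff, coeff_one] at hα
    simp_all

theorem sum_fischer_tensorMonomial (n : ℕ) :
    ∑ i : Fin n → Fin d, fischer (tensorMonomial i) (tensorMonomial i) = d.ascFactorial n := by
  have := sum_fischer_mul_tensorMonomial (isHomogeneous_one (Fin d) ℂ) n
  simpa [fischer_one_one] using this

/-- The symmetric tensor with entries `⟨X_m, f⟩` has squared norm `M! * ‖f‖²`. -/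
theorem sum_fischer_tensorMonomial_mul_star {M : ℕ} {f : MvPolynomial (Fin d) ℂ}
    (hf : f.IsHomogeneous M) :
    ∑ m : Fin M → Fin d, fischer (tensorMonomial m) f * star (fischer (tensorMonomial m) f) =
      (M.factorial : ℂ) * fischer f f := by
  induction M generalizing f with
  | zero =>
    have : f = C (coeff 0 f) := totalDegree_eq_zero_iff_eq_C.mp (by
      have := hf.totalDegree_le
      omega)
    have h1 : f = (coeff 0 f) • (1 : MvPolynomial (Fin d) ℂ) := by
      rw [smul_eq_C_mul, mul_one]; exact this
    rw [h1]
    simp only [fischer_smul_right, fischer_smul_left, tensorMonomial, Finset.univ_eq_empty,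
      Finset.prod_empty, fischer_one_one, mul_one]
    simp
  | succ M ih =>
    rw [sum_fin_succ_pi, Finset.sum_comm]
    simp only [tensorMonomial_cons, fischer_X_mul_left]
    have hd : ∀ x : Fin d, (pderiv x f).IsHomogeneous M := fun x => by
      simpa using hf.pderiv (i := x)
    rw [Finset.sum_congr rfl fun x _ => ih (hd x), ← Finset.mul_sum, sum_fischer_pderiv hf,
      Nat.factorial_succ]
    push_cast
    ring

end Homogeneous

/-! ### Contracting one index with a tensor factor -/

section Contraction

variable {κ σ E : Type*} [DecidableEq κ] [Fintype σ]

/-- Resampling the `k`-th coordinate: each index is hit once for every old value of it. -/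
theorem sum_sum_update [Fintype κ] [AddCommMonoid E] (k : κ) (G : (κ → σ) → E) :
    ∑ m : κ → σ, ∑ y, G (Function.update m k y) = Fintype.card σ • ∑ m, G m := by
  let e : (κ → σ) × σ ≃ (κ → σ) × σ :=
    { toFun := fun p => (Function.update p.1 k p.2, p.1 k)
      invFun := fun p => (Function.update p.1 k p.2, p.1 k)
      left_inv := fun p => by simp
      right_inv := fun p => by simp }
  calc ∑ m : κ → σ, ∑ y, G (Function.update m k y)
      = ∑ p : (κ → σ) × σ, G (e p).1 :=
        (Fintype.sum_prod_type fun p : (κ → σ) × σ => G (Function.update p.1 k p.2)).symm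
    _ = ∑ p : (κ → σ) × σ, G p.1 := e.sum_comp fun p => G p.1
    _ = Fintype.card σ • ∑ m, G m := by
      rw [Fintype.sum_prod_type, Finset.smul_sum]
      simp

/-- The contraction of the free index of `g` with the `k`-th tensor factor. -/
def contract (g : σ → (κ → σ) → ℂ) (k : κ) (m : κ → σ) : ℂ :=
  ∑ y, g y (Function.update m k y)

theorem contract_update (g : σ → (κ → σ) → ℂ) (k : κ) (m : κ → σ) (y : σ) :
    contract g k (Function.update m k y) = contract g k m := by
  simp [contract]

/-- The contraction does not depend on the `k`-th coordinate, so pairing `g` with it along the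
diagonal gives the squared norm of the contraction. -/
theorem card_smul_sum_contract [Fintype κ] (g : σ → (κ → σ) → ℂ) (k : κ) :
    Fintype.card σ • ∑ m : κ → σ, star (contract g k m) * g (m k) m =
      ∑ m, ((‖contract g k m‖ ^ 2 : ℝ) : ℂ) := by
  rw [← sum_sum_update k fun m => star (contract g k m) * g (m k) m]
  refine Finset.sum_congr rfl fun m _ => ?_
  simp only [contract_update, Function.update_self]
  rw [← Finset.mul_sum, Complex.ofReal_pow, ← Complex.conj_mul']
  rfl

theorem card_smul_sum_contract_ite [Fintype κ] [DecidableEq σ] (g : σ → (κ → σ) → ℂ)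
    {k l : κ} (hkl : k ≠ l) :
    Fintype.card σ • ∑ m : κ → σ, (if m k = m l then ‖contract g k m‖ ^ 2 else 0) =
      ∑ m, ‖contract g k m‖ ^ 2 := by
  rw [← sum_sum_update k fun m => if m k = m l then ‖contract g k m‖ ^ 2 else 0]
  refine Finset.sum_congr rfl fun m _ => ?_
  simp [contract_update, Function.update_of_ne hkl.symm]

/-- For `K` tensor factors of dimension `D`, the sum over `k` of the operators projecting onto
the maximally entangled vector of an extra factor with the `k`-th one, scaled by `D`, is at most
`K + D - 1`. Here the quadratic form of this operator at `g` is written out. -/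
theorem sum_contract_le [Fintype κ] [DecidableEq σ] [Nonempty σ] [Nonempty κ]
    (g : σ → (κ → σ) → ℂ) :
    (∑ k, ∑ m : κ → σ, star (contract g k m) * g (m k) m).re ≤
      ((Fintype.card κ : ℝ) + Fintype.card σ - 1) * ∑ x, ∑ m, ‖g x m‖ ^ 2 := by
  set D : ℝ := (Fintype.card σ : ℝ) with hD
  set K : ℝ := (Fintype.card κ : ℝ) with hK
  have hDpos : 0 < D := by rw [hD]; exact_mod_cast Fintype.card_pos
  have hKpos : 1 ≤ K := by rw [hK]; exact_mod_cast Fintype.card_pos (α := κ)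
  -- the squared norm of the `k`-th contraction, as a tensor on the remaining factors
  let Q : κ → ℝ := fun k => D⁻¹ * ∑ m, ‖contract g k m‖ ^ 2
  have hQ : ∀ k, (∑ m : κ → σ, star (contract g k m) * g (m k) m) = (Q k : ℂ) := by
    intro k
    have h := card_smul_sum_contract g k
    rw [nsmul_eq_mul] at h
    have hne : ((Fintype.card σ : ℕ) : ℂ) ≠ 0 := by exact_mod_cast Fintype.card_ne_zero
    simp only [Q, hD]
    push_cast at h ⊢
    rw [← h]
    field_simp
  have hQ' : ∀ k l, k ≠ l →
      ∑ m : κ → σ, (if m k = m l then ‖contract g k m‖ ^ 2 else 0) = Q k := by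
    intro k l hkl
    have h := card_smul_sum_contract_ite g hkl
    rw [nsmul_eq_mul] at h
    simp only [Q]
    rw [← h, ← hD, inv_mul_cancel_left₀ hDpos.ne']
  set S : ℝ := ∑ k, Q k with hS
  -- the sum of the contractions, each tensored back with an unnormalised maximally entangled pair
  let h : σ → (κ → σ) → ℂ := fun x m => ∑ k, if m k = x then contract g k m else 0
  have hre : (∑ k, ∑ m : κ → σ, star (contract g k m) * g (m k) m).re = S := by
    rw [Finset.sum_congr rfl fun k _ => hQ k, ← Complex.ofReal_sum, Complex.ofReal_re]
  -- the pairing of `h` with `g`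
  have hpair : ∑ x, ∑ m : κ → σ, (star (h x m) * g x m).re = S := by
    simp only [← Complex.re_sum]
    rw [← hre, Finset.sum_comm, Finset.sum_comm (γ := κ)]
    refine congrArg Complex.re (Finset.sum_congr rfl fun m _ => ?_)
    simp only [h, star_sum, Finset.sum_mul]
    rw [Finset.sum_comm]
    refine Finset.sum_congr rfl fun k _ => ?_
    rw [Finset.sum_eq_single (m k)]
    · simp
    · intro x _ hx
      rw [if_neg hx.symm, star_zero, zero_mul]
    · simp
  -- the squared norm of `h`: its `k`-th summand has squared norm `D * Q k`, and distinct summands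
  -- `k ≠ l` overlap by at most `√(Q k * Q l) ≤ (Q k + Q l) / 2`
  have hnorm : ∑ x, ∑ m : κ → σ, ‖h x m‖ ^ 2 ≤ (K + D - 1) * S := by
    have hsq : ∀ x m, ‖h x m‖ ^ 2 = ∑ k, ∑ l, if m k = x then if m l = x then
        (star (contract g k m) * contract g l m).re else 0 else 0 := by
      intro x m
      have : ((‖h x m‖ ^ 2 : ℝ) : ℂ) = star (h x m) * h x m := by
        rw [Complex.ofReal_pow, ← Complex.conj_mul']; rfl
      rw [← Complex.ofReal_re (‖h x m‖ ^ 2), this]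
      simp only [h, star_sum, Finset.sum_mul_sum, Complex.re_sum]
      refine Finset.sum_congr rfl fun k _ => Finset.sum_congr rfl fun l _ => ?_
      split_ifs <;> simp
    have hterm : ∀ k l, ∑ m : κ → σ, ∑ x, (if m k = x then if m l = x then
        (star (contract g k m) * contract g l m).re else 0 else 0) ≤
        if k = l then D * Q k else (Q k + Q l) / 2 := by
      intro k l
      have hx : ∀ m : κ → σ, ∑ x, (if m k = x then if m l = x then
          (star (contract g k m) * contract g l m).re else 0 else 0) =
          if m k = m l then (star (contract g k m) * contract g l m).re else 0 := by
        intro m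
        rw [Finset.sum_ite_eq Finset.univ (m k), if_pos (Finset.mem_univ _)]
        exact if_congr eq_comm rfl rfl
      simp only [hx]
      split_ifs with hkl
      · subst hkl
        simp only [if_true, Q]
        rw [mul_inv_cancel_left₀ hDpos.ne']
        refine Finset.sum_le_sum fun m _ => le_of_eq ?_
        rw [Complex.star_def, Complex.conj_mul', ← Complex.ofReal_pow, Complex.ofReal_re]
      · rw [← hQ' k l hkl, ← hQ' l k (Ne.symm hkl), ← Finset.sum_add_distrib, Finset.sum_div]
        refine Finset.sum_le_sum fun m _ => ?_
        by_cases hm : m k = m l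
        · rw [if_pos hm, if_pos hm, if_pos hm.symm]
          have h1 := Complex.re_le_norm (star (contract g k m) * contract g l m)
          rw [norm_mul, norm_star] at h1
          nlinarith [sq_nonneg (‖contract g k m‖ - ‖contract g l m‖)]
        · rw [if_neg hm, if_neg hm, if_neg (Ne.symm hm)]
          norm_num
    have hcount : ∀ k l, (if k = l then D * Q k else (Q k + Q l) / 2) =
        (if k = l then (D - 1) * Q k else 0) + (Q k + Q l) / 2 := by
      intro k l
      split_ifs with hkl
      · subst hkl; ring
      · ring
    calc ∑ x, ∑ m : κ → σ, ‖h x m‖ ^ 2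
        = ∑ k, ∑ l, ∑ m : κ → σ, ∑ x, (if m k = x then if m l = x then
            (star (contract g k m) * contract g l m).re else 0 else 0) := by
          simp only [hsq]
          rw [Finset.sum_comm]
          simp only [
            Finset.sum_comm (s := (Finset.univ : Finset σ)) (t := (Finset.univ : Finset κ)),
            Finset.sum_comm (s := (Finset.univ : Finset (κ → σ))) (t := (Finset.univ : Finset κ))]
      _ ≤ ∑ k, ∑ l, if k = l then D * Q k else (Q k + Q l) / 2 :=
          Finset.sum_le_sum fun k _ => Finset.sum_le_sum fun l _ => hterm k l
      _ = (K + D - 1) * S := by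
          simp only [hcount, Finset.sum_add_distrib, Finset.sum_ite_eq, Finset.mem_univ, if_true,
            ← Finset.mul_sum, ← Finset.sum_div, Finset.sum_const, Finset.card_univ, nsmul_eq_mul]
          rw [← hS, ← hK]
          ring
  have hexp : ∀ x m, ‖h x m - ((K + D - 1 : ℝ) : ℂ) * g x m‖ ^ 2 = ‖h x m‖ ^ 2
      - 2 * (K + D - 1) * (star (h x m) * g x m).re + (K + D - 1) ^ 2 * ‖g x m‖ ^ 2 := by
    intro x m
    generalize K + D - 1 = c
    rw [Complex.star_def, Complex.sq_norm, Complex.sq_norm, Complex.sq_norm, Complex.normSq_apply,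
      Complex.normSq_apply, Complex.normSq_apply]
    simp only [Complex.sub_re, Complex.sub_im, Complex.mul_re, Complex.mul_im, Complex.ofReal_re,
      Complex.ofReal_im, Complex.conj_re, Complex.conj_im]
    ring
  -- the square of `h - (K + D - 1) * g` gives `S ≤ (K + D - 1) * ‖g‖²` without Cauchy-Schwarz
  have hpos : 0 ≤ ∑ x, ∑ m : κ → σ, ‖h x m - ((K + D - 1 : ℝ) : ℂ) * g x m‖ ^ 2 := by positivity
  simp only [hexp, Finset.sum_add_distrib, Finset.sum_sub_distrib, ← Finset.mul_sum, hpair] at hpos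
  rw [hre]
  have hc : 0 < K + D - 1 := by linarith
  nlinarith
end Contraction

/-! ### Kraus decompositions of completely positive maps -/

section Kraus

variable {d N M : ℕ}

/-- Stated for an abstract C⋆-algebra, so that its instances are found by unification for
`CStarMatrix`. -/
theorem exists_eq_star_mul_self {B : Type*} [NonUnitalCStarAlgebra B] [PartialOrder B]
    [StarOrderedRing B] (a : B) (h : 0 ≤ a) : ∃ s : B, a = star s * s :=
  CStarAlgebra.nonneg_iff_eq_star_mul_self.mp h

/-- Choi's theorem: a completely positive map is a sum of conjugations. The Kraus operators are the
rows of a square root of the image of the positive operator matrix `(|i⟩⟨j|)_{i,j}`. -/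
theorem exists_kraus [NeZero d] (φ : Op d N →CP Op d M) :
    ∃ (R : Type) (_ : Fintype R) (v : R → (Fin N → Fin d) → (Fin M → Fin d) → ℂ),
      ∀ i j m m', φ (Matrix.single i j 1) m m' = ∑ r, v r i m * star (v r j m') := by
  let i₀ : Fin N → Fin d := 0
  -- `star T * T` is the operator matrix `(|i⟩⟨j|)_{i,j}`, as `|i⟩⟨j| = |i⟩⟨i₀| * |i₀⟩⟨j|`
  let T : CStarMatrix (Fin N → Fin d) (Fin N → Fin d) (Op d N) :=
    CStarMatrix.ofMatrix fun a j => if a = i₀ then Matrix.single i₀ j 1 else 0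
  have hTe : ∀ a j, T a j = if a = i₀ then Matrix.single i₀ j 1 else 0 := fun _ _ => rfl
  have hT : ∀ i j, (star T * T) i j = Matrix.single i j (1 : ℂ) := by
    intro i j
    rw [CStarMatrix.mul_apply, Finset.sum_eq_single i₀]
    · rw [CStarMatrix.star_apply, hTe, hTe, if_pos rfl, if_pos rfl]
      simp [Matrix.star_eq_conjTranspose]
    · intro a _ ha
      rw [hTe, if_neg ha, mul_zero]
    · simp
  have hpos := φ.map_cstarMatrix_nonneg _ (star_mul_self_nonneg T)
  obtain ⟨s, hs⟩ := exists_eq_star_mul_self _ hpos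
  refine ⟨(Fin N → Fin d) × (Fin M → Fin d), inferInstance,
    fun r i m => star (s r.1 i r.2 m), fun i j m m' => ?_⟩
  have h1 : φ (Matrix.single i j 1) = (star s * s) i j := by
    rw [← hs, CStarMatrix.map_apply, hT]
  rw [h1, CStarMatrix.mul_apply, Matrix.sum_apply, Fintype.sum_prod_type]
  refine Finset.sum_congr rfl fun a _ => ?_
  rw [Matrix.mul_apply]
  refine Finset.sum_congr rfl fun p _ => ?_
  rw [CStarMatrix.star_apply, Matrix.star_apply, star_star]

theorem map_pureInput_of_kraus {φ : Op d N →CP Op d M} {R : Type*} [Fintype R]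
    {v : R → (Fin N → Fin d) → (Fin M → Fin d) → ℂ}
    (hv : ∀ i j m m', φ (Matrix.single i j 1) m m' = ∑ r, v r i m * star (v r j m'))
    (ψ : Fin d → ℂ) (m m' : Fin M → Fin d) :
    φ (pureInput N ψ) m m' = ∑ r, (∑ i, v r i m * tensorVec N ψ i) *
      star (∑ i, v r i m' * tensorVec N ψ i) := by
  have h : pureInput N ψ = ∑ i, ∑ j, (tensorVec N ψ i * star (tensorVec N ψ j)) •
      Matrix.single i j (1 : ℂ) := by
    conv_lhs => rw [Matrix.matrix_eq_sum_single (pureInput N ψ)]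
    simp only [Matrix.smul_single, smul_eq_mul, mul_one]
    rfl
  rw [h]
  simp only [map_sum, map_smul, Matrix.sum_apply, Matrix.smul_apply, hv, smul_eq_mul,
    star_sum, Finset.sum_mul_sum]
  simp only [Finset.mul_sum, Finset.sum_comm (t := (Finset.univ : Finset R))]
  refine Finset.sum_congr rfl fun r _ => Finset.sum_congr rfl fun i _ =>
    Finset.sum_congr rfl fun j _ => ?_
  rw [star_mul']
  ring

/-- An operator matrix `∑ t, (T_t i)ᴴ * T_t j` with rectangular `T_t i` is positive. -/
theorem cstarMatrix_nonneg_of_kraus {k : ℕ} {n R : Type*} [Fintype n] [DecidableEq n] [Nonempty n]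
    [Fintype R] (P : CStarMatrix (Fin k) (Fin k) (Matrix n n ℂ)) (T : R → Fin k → n → ℂ)
    (hP : ∀ i j m m', P i j m m' = ∑ t, star (T t i m) * T t j m') : 0 ≤ P := by
  obtain ⟨m₀⟩ := ‹Nonempty n›
  -- the row `T_t j`, made square by padding with zeros
  let Z : R → Fin k → CStarMatrix (Fin k) (Fin k) (Matrix n n ℂ) := fun t c =>
    CStarMatrix.ofMatrix fun a j => if a = c then
      Matrix.of fun p q => if p = m₀ then T t j q else 0 else 0
  have hZ : ∀ t c a j, Z t c a j = if a = c then
      Matrix.of fun p q => if p = m₀ then T t j q else 0 else 0 := fun _ _ _ _ => rfl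
  rcases Nat.eq_zero_or_pos k with hk | hk
  · subst hk
    exact le_of_eq (CStarMatrix.ext fun i => i.elim0)
  have hsum : P = ∑ t, star (Z t ⟨0, hk⟩) * Z t ⟨0, hk⟩ := by
    have happ : ∀ i j, (∑ t, star (Z t ⟨0, hk⟩) * Z t ⟨0, hk⟩) i j =
        ∑ t, (star (Z t ⟨0, hk⟩) * Z t ⟨0, hk⟩) i j := by
      intro i j
      exact Matrix.sum_apply i j Finset.univ fun t =>
        (star (Z t ⟨0, hk⟩) * Z t ⟨0, hk⟩ : CStarMatrix _ _ _)
    refine CStarMatrix.ext fun i j => ?_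
    rw [happ]
    ext m m'
    rw [hP, Matrix.sum_apply]
    refine Finset.sum_congr rfl fun t _ => ?_
    rw [CStarMatrix.mul_apply, Finset.sum_eq_single ⟨0, hk⟩, Matrix.mul_apply,
      Finset.sum_eq_single m₀, CStarMatrix.star_apply, Matrix.star_apply]
    · rw [hZ, hZ, if_pos rfl, if_pos rfl]
      simp
    · intro p _ hp
      rw [hZ, if_pos rfl, Matrix.of_apply, if_neg hp, mul_zero]
    · simp
    · intro a _ ha
      rw [hZ, if_neg ha, mul_zero]
    · simp
  rw [hsum]
  exact Finset.sum_nonneg fun t _ => star_mul_self_nonneg _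

/-- The completely positive map `ρ ↦ ∑ r, K_r * ρ * K_rᴴ`. -/
def krausMap [NeZero d] {R : Type*} [Fintype R]
    (K : R → Matrix (Fin M → Fin d) (Fin N → Fin d) ℂ) : Op d N →CP Op d M where
  toFun ρ := ∑ r, K r * ρ * (K r)ᴴ
  map_add' ρ τ := by simp only [Matrix.mul_add, Matrix.add_mul, Finset.sum_add_distrib]
  map_smul' c ρ := by
    simp only [Matrix.mul_smul, Matrix.smul_mul, Finset.smul_sum, RingHom.id_apply]
  map_cstarMatrix_nonneg' k P hP := by
    obtain ⟨s, rfl⟩ := exists_eq_star_mul_self _ hP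
    refine cstarMatrix_nonneg_of_kraus _
      (fun (t : R × Fin k × (Fin N → Fin d)) j m => (s t.2.1 j * (K t.1)ᴴ) t.2.2 m) ?_
    intro i j m m'
    have h : ∀ r : R, (K r * (star s * s) i j * (K r)ᴴ) m m' =
        ∑ a, ∑ p, star ((s a i * (K r)ᴴ) p m) * (s a j * (K r)ᴴ) p m' := by
      intro r
      rw [CStarMatrix.mul_apply, Matrix.mul_sum, Matrix.sum_mul, Matrix.sum_apply]
      refine Finset.sum_congr rfl fun a _ => ?_
      have : K r * (star s i a * s a j) * (K r)ᴴ = (s a i * (K r)ᴴ)ᴴ * (s a j * (K r)ᴴ) := by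
        rw [CStarMatrix.star_apply, Matrix.conjTranspose_mul, Matrix.conjTranspose_conjTranspose,
          Matrix.star_eq_conjTranspose]
        simp only [Matrix.mul_assoc]
      rw [this, Matrix.mul_apply]
      rfl
    rw [Fintype.sum_prod_type, CStarMatrix.map_apply]
    simp only [Fintype.sum_prod_type]
    rw [← Finset.sum_congr rfl fun r _ => h r]
    exact Matrix.sum_apply _ _ _ _

theorem krausMap_apply [NeZero d] {R : Type*} [Fintype R]
    (K : R → Matrix (Fin M → Fin d) (Fin N → Fin d) ℂ) (ρ : Op d N) :
    krausMap K ρ = ∑ r, K r * ρ * (K r)ᴴ := rfl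

theorem krausMap_pureInput [NeZero d] {R : Type*} [Fintype R]
    (K : R → Matrix (Fin M → Fin d) (Fin N → Fin d) ℂ) (ψ : Fin d → ℂ) (m m' : Fin M → Fin d) :
    krausMap K (pureInput N ψ) m m' =
      ∑ r, (K r *ᵥ tensorVec N ψ) m * star ((K r *ᵥ tensorVec N ψ) m') := by
  rw [krausMap_apply, Matrix.sum_apply]
  refine Finset.sum_congr rfl fun r _ => ?_
  rw [pureInput, Matrix.mul_vecMulVec, Matrix.vecMulVec_mul, ← Matrix.star_mulVec]
  rfl

end Kraus

/-! ### Averages over pure states as Fischer inner products -/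

section Averages

variable {d n : ℕ} {ι : Type*} [Fintype ι]

theorem isPure_iff {ψ : Fin d → ℂ} : IsPure ψ ↔ ∑ x, ψ x * star (ψ x) = 1 := by
  simp [IsPure, dotProduct, mul_comm]

theorem sum_mul_star_pow (ψ : Fin d → ℂ) (n : ℕ) :
    ∑ i : Fin n → Fin d, eval ψ (tensorMonomial i) * star (eval ψ (tensorMonomial i)) =
      (∑ x, ψ x * star (ψ x)) ^ n := by
  rw [Fintype.sum_pow]
  refine Finset.sum_congr rfl fun i _ => ?_
  rw [eval_tensorMonomial, tensorVec, star_prod, Finset.prod_mul_distrib]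

theorem exists_isPure_smul [NeZero d] (ψ : Fin d → ℂ) :
    ∃ φ : Fin d → ℂ, ∃ s : ℝ, IsPure φ ∧ ψ = (s : ℂ) • φ := by
  by_cases hψ : ψ = 0
  · exact ⟨Pi.single 0 1, 0, by simp [IsPure], by simp [hψ]⟩
  set t : ℝ := ∑ x, ‖ψ x‖ ^ 2 with ht
  have hnorm : ∑ x, ψ x * star (ψ x) = (t : ℂ) := by
    rw [ht, Complex.ofReal_sum]
    refine Finset.sum_congr rfl fun x _ => ?_
    rw [Complex.star_def, Complex.mul_conj', Complex.ofReal_pow]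
  have htpos : 0 < t := by
    obtain ⟨x, hx⟩ := Function.ne_iff.mp hψ
    refine Finset.sum_pos' (fun _ _ => by positivity) ⟨x, Finset.mem_univ _, ?_⟩
    have : 0 < ‖ψ x‖ := norm_pos_iff.mpr hx
    positivity
  have hs : ((Real.sqrt t : ℝ) : ℂ) ≠ 0 := by
    exact_mod_cast (Real.sqrt_pos.mpr htpos).ne'
  have hs2 : ((Real.sqrt t : ℝ) : ℂ) * (Real.sqrt t : ℝ) = t := by
    rw [← Complex.ofReal_mul, Real.mul_self_sqrt htpos.le]
  refine ⟨((Real.sqrt t : ℝ) : ℂ)⁻¹ • ψ, Real.sqrt t, ?_, ?_⟩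
  · rw [isPure_iff]
    have : ∀ x, (((Real.sqrt t : ℝ) : ℂ)⁻¹ • ψ) x * star ((((Real.sqrt t : ℝ) : ℂ)⁻¹ • ψ) x) =
        (t : ℂ)⁻¹ * (ψ x * star (ψ x)) := by
      intro x
      rw [← hs2]
      simp only [Pi.smul_apply, smul_eq_mul, star_mul', Complex.star_def, map_inv₀,
        Complex.conj_ofReal, mul_inv]
      ring
    rw [Finset.sum_congr rfl fun x _ => this x, ← Finset.mul_sum, hnorm,
      inv_mul_cancel₀ (by exact_mod_cast htpos.ne')]
  · rw [smul_smul, mul_inv_cancel₀ hs, one_smul]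

theorem eval_smul_of_isHomogeneous {f : MvPolynomial (Fin d) ℂ} (hf : f.IsHomogeneous n) (c : ℂ)
    (ψ : Fin d → ℂ) : eval (c • ψ) f = c ^ n * eval ψ f := by
  rw [eval_eq', eval_eq', Finset.mul_sum]
  refine Finset.sum_congr rfl fun α hα => ?_
  have hdeg : ∑ x, α x = n := by
    rw [← Finsupp.degree_eq_sum, Finsupp.degree_eq_weight_one]
    exact hf (mem_support_iff.mp hα)
  simp only [Pi.smul_apply, smul_eq_mul, mul_pow, Finset.prod_mul_distrib]
  rw [Finset.prod_pow_eq_pow_sum, hdeg]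
  ring

/-- If a sum of products `f(ψ) * conj (g(ψ))` of homogeneous polynomials of degree `n` has constant
real part `c` on unit vectors, then the Fischer inner products give `c * d (d+1) ⋯ (d+n-1)`. -/
theorem re_sum_fischer_of_const [NeZero d] {f g : ι → MvPolynomial (Fin d) ℂ}
    (hf : ∀ i, (f i).IsHomogeneous n) (hg : ∀ i, (g i).IsHomogeneous n) {c : ℝ}
    (h : ∀ ψ, IsPure ψ → (∑ i, eval ψ (f i) * star (eval ψ (g i))).re = c) :
    (∑ i, fischer (g i) (f i)).re = c * d.ascFactorial n := by
  have hall : ∀ ψ : Fin d → ℂ, ((∑ i, eval ψ (f i) * star (eval ψ (g i))) +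
      ∑ i, eval ψ (g i) * star (eval ψ (f i))) = (2 * c : ℂ) * (∑ x, ψ x * star (ψ x)) ^ n := by
    intro ψ
    obtain ⟨φ, s, hφ, rfl⟩ := exists_isPure_smul ψ
    have h1 : ∑ i, eval φ (g i) * star (eval φ (f i)) =
        star (∑ i, eval φ (f i) * star (eval φ (g i))) := by
      rw [star_sum]
      exact Finset.sum_congr rfl fun i _ => by rw [star_mul', star_star, mul_comm]
    have h2 : (∑ i, eval φ (f i) * star (eval φ (g i))) +
        star (∑ i, eval φ (f i) * star (eval φ (g i))) = _ := Complex.add_conj _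
    rw [h φ hφ] at h2
    have h3 : ∀ p q : MvPolynomial (Fin d) ℂ, p.IsHomogeneous n → q.IsHomogeneous n →
        eval ((s : ℂ) • φ) p * star (eval ((s : ℂ) • φ) q) =
          ((s : ℂ) * s) ^ n * (eval φ p * star (eval φ q)) := by
      intro p q hp hq
      rw [eval_smul_of_isHomogeneous hp, eval_smul_of_isHomogeneous hq, star_mul', star_pow,
        Complex.star_def, Complex.conj_ofReal]
      ring
    have h4 : ∑ x, ((s : ℂ) • φ) x * star (((s : ℂ) • φ) x) = (s : ℂ) * s := by
      have : ∀ x, ((s : ℂ) • φ) x * star (((s : ℂ) • φ) x) =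
          (s : ℂ) * s * (φ x * star (φ x)) := by
        intro x
        simp only [Pi.smul_apply, smul_eq_mul, star_mul', Complex.star_def, Complex.conj_ofReal]
        ring
      rw [Finset.sum_congr rfl fun x _ => this x, ← Finset.mul_sum, isPure_iff.mp hφ, mul_one]
    simp only [h3 _ _ (hf _) (hg _), h3 _ _ (hg _) (hf _), ← Finset.mul_sum]
    rw [h4, ← mul_add, h1, h2]
    push_cast
    ring
  -- the real part is handled by adding the family with `f` and `g` exchanged
  have key := sum_fischer_eq_zero (Finset.univ : Finset ((ι ⊕ ι) ⊕ (Fin n → Fin d)))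
    (Sum.elim (Sum.elim f g) fun i => (-(2 * c : ℂ)) • tensorMonomial i)
    (Sum.elim (Sum.elim g f) tensorMonomial) (by
      intro ψ
      simp only [Fintype.sum_sum_type, Sum.elim_inl, Sum.elim_inr, smul_eval, mul_assoc,
        ← Finset.mul_sum]
      rw [sum_mul_star_pow, hall]
      ring)
  simp only [Fintype.sum_sum_type, Sum.elim_inl, Sum.elim_inr, fischer_smul_right,
    ← Finset.mul_sum, sum_fischer_tensorMonomial] at key
  have h1 : ∑ i, fischer (f i) (g i) = star (∑ i, fischer (g i) (f i)) := by
    rw [star_sum]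
    exact Finset.sum_congr rfl fun i _ => fischer_comm _ _
  rw [h1, Complex.star_def, Complex.add_conj] at key
  have h5 : ((2 * (∑ i, fischer (g i) (f i)).re : ℝ) : ℂ) =
      ((2 * (c * d.ascFactorial n) : ℝ) : ℂ) := by
    push_cast at key ⊢
    linear_combination key
  have h6 := Complex.ofReal_injective h5
  linarith

end Averages

/-! ### The upper bound on the fidelity -/

section UpperBound

variable {d N M : ℕ}

theorem star_dotProduct_reducedState_mulVec (k : Fin M) (ρ : Op d M) (χ : Fin d → ℂ) :
    star χ ⬝ᵥ (reducedState k ρ *ᵥ χ) =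
      ∑ m, ∑ y, star (χ (m k)) * χ y * ρ m (Function.update m k y) := by
  simp only [dotProduct, Matrix.mulVec, reducedState, Matrix.of_apply, Pi.star_apply,
    Finset.mul_sum, Finset.sum_mul]
  rw [Finset.sum_congr rfl fun x _ => Finset.sum_comm, ← Finset.sum_fiberwise Finset.univ
    (fun m : Fin M → Fin d => m k)]
  refine Finset.sum_congr rfl fun x _ => Finset.sum_congr rfl fun m hm =>
    Finset.sum_congr rfl fun y _ => ?_
  rw [(Finset.mem_filter.mp hm).2]
  ring

/-- The inequality `sum_contract_le`, coefficient by coefficient. -/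
theorem sum_contract_fischer_le [NeZero d] [NeZero M]
    (g : Fin d → (Fin M → Fin d) → MvPolynomial (Fin d) ℂ) :
    (∑ k, ∑ m, ∑ y, fischer (g y (Function.update m k y)) (g (m k) m)).re ≤
      ((M : ℝ) + d - 1) * (∑ x, ∑ m, fischer (g x m) (g x m)).re := by
  classical
  let D : Finset (Fin d →₀ ℕ) := Finset.univ.biUnion fun p : Fin d × (Fin M → Fin d) =>
    (g p.1 p.2).support
  have hD : ∀ x m, (g x m).support ⊆ D := fun x m =>
    Finset.subset_biUnion_of_mem (fun p : Fin d × (Fin M → Fin d) => (g p.1 p.2).support)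
      (Finset.mem_univ (x, m))
  let c : (Fin d →₀ ℕ) → Fin d → (Fin M → Fin d) → ℂ := fun α x m => coeff α (g x m)
  have h1 : ∑ k, ∑ m, ∑ y, fischer (g y (Function.update m k y)) (g (m k) m) =
      ∑ α ∈ D, (multiFactorial α : ℂ) *
        ∑ k, ∑ m : Fin M → Fin d, star (contract (c α) k m) * c α (m k) m := by
    simp only [fischer_eq_sum (hD _ _), Finset.sum_comm (t := D), Finset.mul_sum, contract,
      star_sum, Finset.sum_mul, c, mul_assoc]
  have h2 : ∑ x, ∑ m, fischer (g x m) (g x m) =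
      ((∑ α ∈ D, multiFactorial α * ∑ x, ∑ m, ‖c α x m‖ ^ 2 : ℝ) : ℂ) := by
    simp only [fischer_self _ (hD _ _), ← Complex.ofReal_sum, Finset.sum_comm (t := D),
      Finset.mul_sum, c]
  rw [h1, h2, Complex.ofReal_re, Complex.re_sum, Finset.mul_sum]
  refine Finset.sum_le_sum fun α _ => ?_
  rw [Complex.re_ofReal_mul, mul_left_comm]
  refine mul_le_mul_of_nonneg_left ?_ (multiFactorial_nonneg α)
  simpa using sum_contract_le (c α)

theorem fischer_X_mul_X_mul (a y : Fin d) (f g : MvPolynomial (Fin d) ℂ) :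
    fischer (X a * f) (X y * g) =
      (if a = y then fischer f g else 0) + fischer (pderiv y f) (pderiv a g) := by
  rw [fischer_X_mul_left, pderiv_mul, fischer_add_right, fischer_X_mul_right, pderiv_X]
  congr 1
  split_ifs with h
  · subst h; simp
  · rw [Pi.single_eq_of_ne (Ne.symm h), zero_mul, ← zero_smul ℂ (0 : MvPolynomial (Fin d) ℂ),
      fischer_smul_right, zero_mul]

/-- The bound on the single-copy fidelity `F` of a cloning machine all of whose clones have fidelity
`F` on all pure states. -/
theorem fidelity_le_of_const [NeZero d] (hM : 1 ≤ M) (L : CloningMachine d N M) {F : ℝ}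
    (hF : ∀ ψ, IsPure ψ → ∀ k, overlap ψ (L.clone k ψ) = F) :
    F ≤ ((M : ℝ) - N + N * (M + d)) / (M * (N + d)) := by
  have : NeZero M := ⟨by omega⟩
  obtain ⟨R, _, v, hv⟩ := exists_kraus L.map
  -- the components of the Kraus vectors at `ψ^{⊗N}`, as polynomials in `ψ`
  let V : R → (Fin M → Fin d) → MvPolynomial (Fin d) ℂ :=
    fun r m => ∑ i, v r i m • tensorMonomial i
  have hV : ∀ r m, (V r m).IsHomogeneous N := fun r m =>
    IsHomogeneous.sum _ _ _ fun i _ => by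
      rw [smul_eq_C_mul]
      simpa using (isHomogeneous_C _ (v r i m)).mul (tensorMonomial_isHomogeneous i)
  have hmap : ∀ ψ m m', L.map (pureInput N ψ) m m' =
      ∑ r, eval ψ (V r m) * star (eval ψ (V r m')) := by
    intro ψ m m'
    rw [map_pureInput_of_kraus hv]
    simp only [V, map_sum, smul_eval, eval_tensorMonomial]
  set T : ℝ := (∑ r, ∑ m, fischer (V r m) (V r m)).re with hT
  have htrace : T = d.ascFactorial N := by
    have := re_sum_fischer_of_const (ι := R × (Fin M → Fin d))
      (f := fun p => V p.1 p.2) (g := fun p => V p.1 p.2) (c := 1) (fun p => hV p.1 p.2)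
      (fun p => hV p.1 p.2) (by
        intro ψ hψ
        rw [Fintype.sum_prod_type_right]
        simp only [← hmap]
        have := L.trace_map ψ hψ
        rw [Matrix.trace] at this
        simp only [Matrix.diag_apply] at this
        rw [this, Complex.one_re])
    rw [Fintype.sum_prod_type, one_mul] at this
    exact this
  -- what is left of the fidelity of the `k`-th clone after commuting `∂` past `X`
  let B : Fin M → ℂ := fun k => ∑ r, ∑ m, ∑ y,
    fischer (pderiv y (V r (Function.update m k y))) (pderiv (m k) (V r m))
  have hfid : ∀ k, T + (B k).re = F * d.ascFactorial (N + 1) := by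
    intro k
    have hX : ∀ a r m, (X a * V r m).IsHomogeneous (N + 1) := fun a r m => by
      simpa [add_comm] using (isHomogeneous_X ℂ a).mul (hV r m)
    have := re_sum_fischer_of_const
      (ι := R × (Fin M → Fin d) × Fin d)
      (f := fun p => X p.2.2 * V p.1 p.2.1)
      (g := fun p => X (p.2.1 k) * V p.1 (Function.update p.2.1 k p.2.2)) (c := F)
      (fun p => hX _ _ _) (fun p => hX _ _ _) (by
        intro ψ hψ
        rw [← hF ψ hψ k, overlap, CloningMachine.clone, star_dotProduct_reducedState_mulVec]
        simp only [Fintype.sum_prod_type]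
        rw [Finset.sum_comm]
        congr 1
        refine Finset.sum_congr rfl fun m _ => ?_
        rw [Finset.sum_comm]
        refine Finset.sum_congr rfl fun y _ => ?_
        rw [hmap, Finset.mul_sum]
        refine Finset.sum_congr rfl fun r _ => ?_
        simp only [map_mul, eval_X, star_mul']
        ring)
    rw [← this, hT, ← Complex.add_re, ← Finset.sum_add_distrib]
    simp only [Fintype.sum_prod_type, fischer_X_mul_X_mul, Finset.sum_add_distrib,
      Finset.sum_ite_eq, Finset.mem_univ, if_true, Function.update_eq_self]
  have hB : (∑ k, B k).re ≤ ((M : ℝ) + d - 1) * (N * T) := by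
    have h1 : ∑ k, B k = ∑ r, ∑ k, ∑ m, ∑ y,
        fischer (pderiv y (V r (Function.update m k y))) (pderiv (m k) (V r m)) := by
      simp only [B]
      exact Finset.sum_comm
    have h2 : (N : ℝ) * T = ∑ r, (∑ x, ∑ m, fischer (pderiv x (V r m)) (pderiv x (V r m))).re := by
      rw [hT, ← Complex.re_sum, ← Complex.re_ofReal_mul]
      congr 1
      rw [Finset.mul_sum]
      refine Finset.sum_congr rfl fun r _ => ?_
      rw [Finset.sum_comm, Finset.mul_sum]
      refine Finset.sum_congr rfl fun m _ => ?_
      rw [sum_fischer_pderiv (hV r m), Complex.ofReal_natCast]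
    rw [h1, h2, Complex.re_sum, Finset.mul_sum]
    exact Finset.sum_le_sum fun r _ =>
      sum_contract_fischer_le fun x m => pderiv x (V r m)
  have hsum : (M : ℝ) * T + (∑ k, B k).re = M * (F * d.ascFactorial (N + 1)) := by
    have := Finset.sum_congr (rfl : (Finset.univ : Finset (Fin M)) = _) fun k _ => hfid k
    simpa [Finset.sum_add_distrib] using this
  have hd : 0 < d := Nat.pos_of_neZero d
  have hasc : (0 : ℝ) < d.ascFactorial N := by
    have : 0 < d.ascFactorial N := by
      obtain ⟨e, rfl⟩ : ∃ e, d = e + 1 := ⟨d - 1, by omega⟩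
      exact Nat.ascFactorial_pos e N
    exact_mod_cast this
  rw [Nat.ascFactorial_succ, htrace] at hsum
  rw [htrace] at hB
  push_cast at hsum
  have hMpos : (0 : ℝ) < M := by exact_mod_cast hM
  have hdpos : (0 : ℝ) < d := by exact_mod_cast hd
  rw [le_div_iff₀ (by positivity)]
  refine le_of_mul_le_mul_right ?_ hasc
  nlinarith

end UpperBound

/-! ### The false-accept probability equals the fidelity -/

section FalseAccept

variable {d N M n : ℕ}

theorem reducedState_eq_sum_insertNth (k : Fin (n + 1)) (ρ : Op d (n + 1)) (x y : Fin d) :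
    reducedState k ρ x y = ∑ m : Fin n → Fin d,
      ρ (k.insertNth (α := fun _ => Fin d) x m) (k.insertNth (α := fun _ => Fin d) y m) := by
  rw [reducedState, Matrix.of_apply, Finset.sum_filter,
    ← (Fin.insertNthEquiv (fun _ => Fin d) k).sum_comp, Fintype.sum_prod_type_right]
  refine Finset.sum_congr rfl fun m _ => ?_
  simp [Fin.insertNthEquiv]

theorem tensorOp_insertNth (k : Fin (n + 1)) (A : Matrix (Fin d) (Fin d) ℂ) (x y : Fin d)
    (m i : Fin n → Fin d) :
    tensorOp (n + 1) A (k.insertNth (α := fun _ => Fin d) x m)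
      (k.insertNth (α := fun _ => Fin d) y i) = A x y * tensorOp n A m i := by
  simp [tensorOp, Fin.prod_univ_succAbove _ k]

theorem tensorOp_conjTranspose_mul_self {R : Matrix (Fin d) (Fin d) ℂ}
    (hR : R ∈ Matrix.unitaryGroup (Fin d) ℂ) : (tensorOp n R)ᴴ * tensorOp n R = 1 := by
  ext i j
  have hR' : ∀ a b, ∑ x, star (R x a) * R x b = (1 : Matrix (Fin d) (Fin d) ℂ) a b := by
    intro a b
    rw [← (Unitary.mem_iff.mp hR).1, Matrix.mul_apply]
    rfl
  simp only [Matrix.mul_apply, Matrix.conjTranspose_apply, tensorOp, Matrix.of_apply, star_prod,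
    ← Finset.prod_mul_distrib]
  rw [← Fintype.prod_sum fun a x => star (R x (i a)) * R x (j a)]
  simp only [hR', Matrix.one_apply, funext_iff]
  rw [Fintype.prod_ite_zero, Finset.prod_const_one]
  congr

/-- Applying a unitary to every factor conjugates each reduced state. -/
theorem reducedState_tensorOp_mul {R : Matrix (Fin d) (Fin d) ℂ}
    (hR : R ∈ Matrix.unitaryGroup (Fin d) ℂ) (k : Fin (n + 1)) (ρ : Op d (n + 1)) :
    reducedState k (tensorOp (n + 1) R * ρ * (tensorOp (n + 1) R)ᴴ) =
      R * reducedState k ρ * Rᴴ := by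
  ext x y
  let ι : Fin d → (Fin n → Fin d) → Fin (n + 1) → Fin d :=
    fun x m => k.insertNth (α := fun _ => Fin d) x m
  have hsum : ∀ F : (Fin (n + 1) → Fin d) → ℂ, ∑ i, F i = ∑ a, ∑ i', F (ι a i') := by
    intro F
    rw [← (Fin.insertNthEquiv (fun _ => Fin d) k).sum_comp, Fintype.sum_prod_type]
    rfl
  have hun : ∀ i' j' : Fin n → Fin d, ∑ m, tensorOp n R m i' * star (tensorOp n R m j') =
      if j' = i' then 1 else 0 := by
    intro i' j'
    have := congrFun (congrFun (tensorOp_conjTranspose_mul_self (n := n) hR) j') i'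
    rw [Matrix.mul_apply, Matrix.one_apply] at this
    rw [← this]
    exact Finset.sum_congr rfl fun m _ => mul_comm _ _
  calc reducedState k (tensorOp (n + 1) R * ρ * (tensorOp (n + 1) R)ᴴ) x y
      = ∑ m, ∑ b, ∑ j', ∑ a, ∑ i', R x a * tensorOp n R m i' * ρ (ι a i') (ι b j') *
          star (R y b * tensorOp n R m j') := by
        rw [reducedState_eq_sum_insertNth]
        refine Finset.sum_congr rfl fun m _ => ?_
        rw [Matrix.mul_apply, hsum]
        refine Finset.sum_congr rfl fun b _ => Finset.sum_congr rfl fun j' _ => ?_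
        rw [Matrix.mul_apply, hsum, Finset.sum_mul]
        refine Finset.sum_congr rfl fun a _ => ?_
        rw [Finset.sum_mul]
        refine Finset.sum_congr rfl fun i' _ => ?_
        rw [tensorOp_insertNth, Matrix.conjTranspose_apply, tensorOp_insertNth]
    _ = ∑ b, ∑ j', ∑ a, ∑ i', R x a * ρ (ι a i') (ι b j') * star (R y b) *
          ∑ m, tensorOp n R m i' * star (tensorOp n R m j') := by
        rw [Finset.sum_comm]
        refine Finset.sum_congr rfl fun b _ => ?_
        rw [Finset.sum_comm]
        refine Finset.sum_congr rfl fun j' _ => ?_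
        rw [Finset.sum_comm]
        refine Finset.sum_congr rfl fun a _ => ?_
        rw [Finset.sum_comm]
        refine Finset.sum_congr rfl fun i' _ => ?_
        rw [Finset.mul_sum]
        refine Finset.sum_congr rfl fun m _ => ?_
        rw [star_mul']
        ring
    _ = (R * reducedState k ρ * Rᴴ) x y := by
        rw [Matrix.mul_apply]
        refine Finset.sum_congr rfl fun b _ => ?_
        rw [Matrix.mul_apply, Finset.sum_mul, Finset.sum_comm]
        refine Finset.sum_congr rfl fun a _ => ?_
        rw [reducedState_eq_sum_insertNth, Finset.mul_sum, Finset.sum_mul]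
        refine Finset.sum_congr rfl fun j' _ => ?_
        simp only [hun, mul_ite, mul_one, mul_zero, Finset.sum_ite_eq, Finset.mem_univ, if_true]
        rfl

theorem overlap_mulVec {R : Matrix (Fin d) (Fin d) ℂ} (hR : R ∈ Matrix.unitaryGroup (Fin d) ℂ)
    (χ : Fin d → ℂ) (A : Matrix (Fin d) (Fin d) ℂ) :
    overlap (R *ᵥ χ) (R * A * Rᴴ) = overlap χ A := by
  have hR' : Rᴴ * R = 1 := (Unitary.mem_iff.mp hR).1
  rw [overlap, overlap, Matrix.mulVec_mulVec, Matrix.mul_assoc, hR', Matrix.mul_one,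
    Matrix.star_mulVec, ← Matrix.dotProduct_mulVec, Matrix.mulVec_mulVec, ← Matrix.mul_assoc, hR',
    Matrix.one_mul]

theorem overlap_response {R : Matrix (Fin d) (Fin d) ℂ}
    (hR : R ∈ Matrix.unitaryGroup (Fin d) ℂ) (L : CloningMachine d N M) (k : Fin M)
    (ψ : Fin d → ℂ) :
    overlap (R *ᵥ ψ) (reducedState k (L.response R ψ)) = overlap ψ (L.clone k ψ) := by
  cases M with
  | zero => exact k.elim0
  | succ n => rw [CloningMachine.response, reducedState_tensorOp_mul hR, overlap_mulVec hR,
      CloningMachine.clone]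

instance (d : ℕ) : IsProbabilityMeasure (haarUnitary d) :=
  ⟨by
    have := Measure.haarMeasure_self
      (K₀ := (⊤ : TopologicalSpace.PositiveCompacts (Matrix.unitaryGroup (Fin d) ℂ)))
    rwa [TopologicalSpace.PositiveCompacts.coe_top] at this⟩

theorem isPure_unitary_mulVec [NeZero d] (U : Matrix.unitaryGroup (Fin d) ℂ) :
    IsPure (U.1 *ᵥ Pi.single 0 1) := by
  have h : U.1ᴴ * U.1 = 1 := (Unitary.mem_iff.mp U.2).1
  rw [IsPure, Matrix.star_mulVec, ← Matrix.dotProduct_mulVec, Matrix.mulVec_mulVec, h,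
    Matrix.one_mulVec]
  simp

theorem pureAverage_of_const [NeZero d] {f : (Fin d → ℂ) → ℝ} {c : ℝ}
    (hf : ∀ ψ, IsPure ψ → f ψ = c) : pureAverage f = c := by
  rw [pureAverage, integral_congr_ae (Filter.Eventually.of_forall fun U =>
    hf _ (isPure_unitary_mulVec U))]
  simp

theorem fidelity_of_const [NeZero d] (hM : 1 ≤ M) {L : CloningMachine d N M} {F : ℝ}
    (hF : ∀ ψ, IsPure ψ → ∀ k, overlap ψ (L.clone k ψ) = F) : L.fidelity = F := by
  have hM' : (M : ℝ) ≠ 0 := by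
    have : 0 < M := hM
    exact_mod_cast this.ne'
  have : ∀ k : Fin M, (pureAverage fun ψ => (1 / (M : ℝ)) * overlap ψ (L.clone k ψ)) =
      (1 / (M : ℝ)) * F := fun k =>
    pureAverage_of_const fun ψ hψ => by rw [hF ψ hψ k]
  rw [CloningMachine.fidelity, Finset.sum_congr rfl fun k _ => this k]
  simp only [Finset.sum_const, Finset.card_univ, Fintype.card_fin, nsmul_eq_mul]
  field_simp

theorem falseAccept_of_const [NeZero d] {R : Matrix (Fin d) (Fin d) ℂ}
    (hR : R ∈ Matrix.unitaryGroup (Fin d) ℂ) {L : CloningMachine d N M} {F : ℝ}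
    (hF : ∀ ψ, IsPure ψ → ∀ k, overlap ψ (L.clone k ψ) = F) (k : Fin M) :
    L.falseAccept R k = F :=
  pureAverage_of_const fun ψ hψ => by rw [overlap_response hR, hF ψ hψ k]

/-- All clones of a universal cloning machine have the same fidelity on all pure states. -/
theorem CloningMachine.IsUniversal.exists_const [NeZero d] (hM : 1 ≤ M)
    {L : CloningMachine d N M} (hL : L.IsUniversal) :
    ∃ F, ∀ ψ, IsPure ψ → ∀ k, overlap ψ (L.clone k ψ) = F := by
  have hpure : IsPure (Pi.single 0 1 : Fin d → ℂ) := by simp [IsPure]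
  refine ⟨overlap (Pi.single 0 1) (L.clone ⟨0, hM⟩ (Pi.single 0 1)), fun ψ hψ k => ?_⟩
  rw [hL.same_clones ψ hψ k ⟨0, hM⟩]
  exact hL.state_independent _ _ hψ hpure _

end FalseAccept

/-! ### Creation and annihilation of a state -/

section Creation

variable {d : ℕ}

/-- The linear form `∑ x, ψ_x X_x`; multiplication by it creates a particle in the state `ψ`. -/
def linearForm (ψ : Fin d → ℂ) : MvPolynomial (Fin d) ℂ := ∑ x, ψ x • X x

/-- The directional derivative along `conj ψ`, the Fischer adjoint of multiplication by
`linearForm ψ`. -/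
def annihilate (ψ : Fin d → ℂ) (f : MvPolynomial (Fin d) ℂ) : MvPolynomial (Fin d) ℂ :=
  ∑ x, star (ψ x) • pderiv x f

theorem linearForm_isHomogeneous (ψ : Fin d → ℂ) : (linearForm ψ).IsHomogeneous 1 :=
  IsHomogeneous.sum _ _ _ fun x _ => by
    rw [smul_eq_C_mul]
    simpa using (isHomogeneous_C _ (ψ x)).mul (isHomogeneous_X ℂ x)

theorem linearForm_pow (ψ : Fin d → ℂ) (n : ℕ) :
    linearForm ψ ^ n = ∑ i : Fin n → Fin d, tensorVec n ψ i • tensorMonomial i := by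
  rw [linearForm, Fintype.sum_pow]
  exact Finset.sum_congr rfl fun i _ => by rw [Finset.prod_smul]; rfl

theorem fischer_linearForm_mul_left (ψ : Fin d → ℂ) (f g : MvPolynomial (Fin d) ℂ) :
    fischer (linearForm ψ * f) g = fischer f (annihilate ψ g) := by
  rw [linearForm, annihilate, Finset.sum_mul, fischer_sum_left, fischer_sum_right]
  refine Finset.sum_congr rfl fun x _ => ?_
  rw [smul_mul_assoc, fischer_smul_left, fischer_smul_right, fischer_X_mul_left]

theorem fischer_annihilate_left (ψ : Fin d → ℂ) (f g : MvPolynomial (Fin d) ℂ) :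
    fischer (annihilate ψ f) g = fischer f (linearForm ψ * g) := by
  rw [fischer_comm, ← fischer_linearForm_mul_left, ← fischer_comm]

/-- The canonical commutation relation. -/
theorem annihilate_linearForm_mul {ψ : Fin d → ℂ} (hψ : IsPure ψ) (f : MvPolynomial (Fin d) ℂ) :
    annihilate ψ (linearForm ψ * f) = f + linearForm ψ * annihilate ψ f := by
  have h : ∀ x, pderiv x (linearForm ψ) = C (ψ x) := by
    intro x
    simp only [linearForm, map_sum, Derivation.map_smul, pderiv_X]
    rw [Finset.sum_eq_single x]
    · rw [Pi.single_eq_same, smul_eq_C_mul, mul_one]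
    · intro y _ hy
      rw [Pi.single_eq_of_ne hy, smul_zero]
    · simp
  simp only [annihilate, pderiv_mul, h, smul_add, Finset.sum_add_distrib, Finset.mul_sum,
    mul_smul_comm]
  congr 1
  simp only [← smul_eq_C_mul, smul_smul]
  rw [← Finset.sum_smul, Finset.sum_congr rfl fun x _ => mul_comm (star (ψ x)) (ψ x),
    isPure_iff.mp hψ, one_smul]

theorem annihilate_linearForm_pow {ψ : Fin d → ℂ} (hψ : IsPure ψ) (n : ℕ) :
    annihilate ψ (linearForm ψ ^ (n + 1)) = ((n : ℂ) + 1) • linearForm ψ ^ n := by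
  induction n with
  | zero =>
    rw [zero_add, pow_one, ← mul_one (linearForm ψ), annihilate_linearForm_mul hψ]
    simp [annihilate]
  | succ n ih =>
    rw [pow_succ' _ (n + 1), annihilate_linearForm_mul hψ, ih, mul_smul_comm, ← pow_succ']
    push_cast
    module

theorem fischer_linearForm_pow {ψ : Fin d → ℂ} (hψ : IsPure ψ) (n : ℕ) :
    fischer (linearForm ψ ^ n) (linearForm ψ ^ n) = n.factorial := by
  induction n with
  | zero => simp [fischer_one_one]
  | succ n ih =>
    rw [pow_succ' _ n, fischer_linearForm_mul_left, ← pow_succ', annihilate_linearForm_pow hψ,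
      fischer_smul_right, ih, Nat.factorial_succ]
    push_cast
    ring

/-- `‖a f‖² = ‖a† f‖² - ‖f‖²` for annihilation `a` and creation `a†`. -/
theorem fischer_annihilate_self {ψ : Fin d → ℂ} (hψ : IsPure ψ) (f : MvPolynomial (Fin d) ℂ) :
    fischer (annihilate ψ f) (annihilate ψ f) =
      fischer (linearForm ψ * f) (linearForm ψ * f) - fischer f f := by
  rw [fischer_linearForm_mul_left ψ f, annihilate_linearForm_mul hψ, fischer_add_right,
    fischer_annihilate_left]
  ring

theorem annihilate_isHomogeneous {n : ℕ} (ψ : Fin d → ℂ) {f : MvPolynomial (Fin d) ℂ}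
    (hf : f.IsHomogeneous (n + 1)) : (annihilate ψ f).IsHomogeneous n :=
  IsHomogeneous.sum _ _ _ fun x _ => by
    rw [smul_eq_C_mul]
    simpa using (isHomogeneous_C _ (star (ψ x))).mul (hf.pderiv (i := x))

end Creation

/-! ### The optimal cloning machine -/

section OptimalCloner

variable {d N n s : ℕ}

/-- The normalisation of the optimal cloning machine for `n + 1 = N + s`: the inverse of
the sum over `r` of the squared norms of the tensors `⟨X_m, (∑ x, ψ_x X_x) ^ N * X_r⟩`. -/
def clonerWeight (d N s n : ℕ) : ℝ :=
  1 / ((n + 1).factorial * ((N + d).ascFactorial s * N.factorial))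

/-- The Kraus operators of the optimal cloning machine: up to a scalar, the `r`-th one tensors its
argument with the basis vector `r` and symmetrises. -/
def clonerKraus (d N s n : ℕ) (r : Fin s → Fin d) :
    Matrix (Fin (n + 1) → Fin d) (Fin N → Fin d) ℂ :=
  Matrix.of fun m i => (Real.sqrt (clonerWeight d N s n) : ℂ) *
    fischer (tensorMonomial m) (tensorMonomial i * tensorMonomial r)

theorem clonerWeight_nonneg : 0 ≤ clonerWeight d N s n := by
  unfold clonerWeight
  positivity

/-- The polynomial of the symmetrisation of `ψ^{⊗N} ⊗ e_r`. -/
def clonerPolynomial (N : ℕ) (ψ : Fin d → ℂ) (r : Fin s → Fin d) : MvPolynomial (Fin d) ℂ :=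
  linearForm ψ ^ N * tensorMonomial r

theorem linearForm_pow_isHomogeneous (ψ : Fin d → ℂ) (N : ℕ) :
    (linearForm ψ ^ N).IsHomogeneous N := by
  simpa using (linearForm_isHomogeneous ψ).pow N

theorem clonerPolynomial_isHomogeneous (hs : N + s = n + 1) (ψ : Fin d → ℂ) (r : Fin s → Fin d) :
    (clonerPolynomial N ψ r).IsHomogeneous (n + 1) :=
  hs ▸ (linearForm_pow_isHomogeneous ψ N).mul (tensorMonomial_isHomogeneous r)

theorem clonerKraus_mulVec (ψ : Fin d → ℂ) (r : Fin s → Fin d) (m : Fin (n + 1) → Fin d) :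
    (clonerKraus d N s n r *ᵥ tensorVec N ψ) m = (Real.sqrt (clonerWeight d N s n) : ℂ) *
      fischer (tensorMonomial m) (clonerPolynomial N ψ r) := by
  simp only [Matrix.mulVec, dotProduct, clonerKraus, Matrix.of_apply, clonerPolynomial,
    linearForm_pow, Finset.sum_mul, fischer_sum_right, Finset.mul_sum, smul_mul_assoc,
    fischer_smul_right]
  exact Finset.sum_congr rfl fun i _ => by ring

theorem krausMap_clonerKraus [NeZero d] (ψ : Fin d → ℂ) (m m' : Fin (n + 1) → Fin d) :
    krausMap (clonerKraus d N s n) (pureInput N ψ) m m' = (clonerWeight d N s n : ℂ) *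
      ∑ r : Fin s → Fin d, fischer (tensorMonomial m) (clonerPolynomial N ψ r) *
        star (fischer (tensorMonomial m') (clonerPolynomial N ψ r)) := by
  have hw : (Real.sqrt (clonerWeight d N s n) : ℂ) * (Real.sqrt (clonerWeight d N s n) : ℂ) =
      clonerWeight d N s n := by
    rw [← Complex.ofReal_mul, Real.mul_self_sqrt clonerWeight_nonneg]
  rw [krausMap_pureInput, Finset.mul_sum]
  refine Finset.sum_congr rfl fun r _ => ?_
  rw [clonerKraus_mulVec, clonerKraus_mulVec, star_mul', ← hw, Complex.star_def,
    Complex.conj_ofReal]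
  ring

theorem sum_fischer_clonerPolynomial {ψ : Fin d → ℂ} (hψ : IsPure ψ) (N s : ℕ) :
    ∑ r : Fin s → Fin d, fischer (clonerPolynomial N ψ r) (clonerPolynomial N ψ r) =
      ((N + d).ascFactorial s : ℂ) * N.factorial := by
  rw [← fischer_linearForm_pow hψ]
  exact sum_fischer_mul_tensorMonomial (linearForm_pow_isHomogeneous ψ N) s

theorem ascFactorial_add_ne_zero [NeZero d] (N s : ℕ) : ((N + d).ascFactorial s) ≠ 0 := by
  have hd : 0 < d := Nat.pos_of_neZero d
  obtain ⟨e, he⟩ : ∃ e, N + d = e + 1 := ⟨N + d - 1, by omega⟩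
  rw [he]
  exact (Nat.ascFactorial_pos e s).ne'

/-- The optimal cloning machine, which tensors the `N` originals with the maximally mixed state on
`s` further factors, compresses to the symmetric subspace and rescales to trace one. -/
def optimalCloner (d N s n : ℕ) [NeZero d] (hs : N + s = n + 1) : CloningMachine d N (n + 1) where
  map := krausMap (clonerKraus d N s n)
  trace_map ψ hψ := by
    have h0 : ((N + d).ascFactorial s : ℂ) ≠ 0 := by exact_mod_cast ascFactorial_add_ne_zero N s
    have h1 : ((n + 1).factorial : ℂ) ≠ 0 := by exact_mod_cast Nat.factorial_ne_zero _
    have h2 : (N.factorial : ℂ) ≠ 0 := by exact_mod_cast Nat.factorial_ne_zero _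
    simp only [Matrix.trace, Matrix.diag_apply, krausMap_clonerKraus, ← Finset.mul_sum]
    rw [Finset.sum_comm, Finset.sum_congr rfl fun r _ =>
      sum_fischer_tensorMonomial_mul_star (clonerPolynomial_isHomogeneous hs ψ r),
      ← Finset.mul_sum, sum_fischer_clonerPolynomial hψ, clonerWeight]
    push_cast
    field_simp

theorem optimalCloner_clone [NeZero d] (hs : N + s = n + 1) (k : Fin (n + 1)) (ψ : Fin d → ℂ)
    (x y : Fin d) :
    (optimalCloner d N s n hs).clone k ψ x y = (clonerWeight d N s n : ℂ) *
      ∑ m : Fin n → Fin d, ∑ r : Fin s → Fin d,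
        fischer (X x * tensorMonomial m) (clonerPolynomial N ψ r) *
          star (fischer (X y * tensorMonomial m) (clonerPolynomial N ψ r)) := by
  rw [CloningMachine.clone, reducedState_eq_sum_insertNth, Finset.mul_sum]
  refine Finset.sum_congr rfl fun m _ => ?_
  rw [← tensorMonomial_insertNth k, ← tensorMonomial_insertNth k]
  exact krausMap_clonerKraus ψ _ _

/-- Projecting a clone onto `ψ` annihilates one particle in the state `ψ`. -/
theorem star_dotProduct_optimalCloner_clone [NeZero d] (hs : N + s = n + 1) (k : Fin (n + 1))
    (ψ : Fin d → ℂ) :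
    star ψ ⬝ᵥ ((optimalCloner d N s n hs).clone k ψ *ᵥ ψ) = (clonerWeight d N s n : ℂ) *
      ∑ r : Fin s → Fin d, ((n.factorial : ℂ) * fischer (annihilate ψ (clonerPolynomial N ψ r))
        (annihilate ψ (clonerPolynomial N ψ r))) := by
  let A : (Fin n → Fin d) → (Fin s → Fin d) → Fin d → ℂ := fun m r x =>
    fischer (X x * tensorMonomial m) (clonerPolynomial N ψ r)
  have hA : ∀ m r, star ψ ⬝ᵥ A m r =
      fischer (tensorMonomial m) (annihilate ψ (clonerPolynomial N ψ r)) := by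
    intro m r
    simp only [A, annihilate, dotProduct, Pi.star_apply, fischer_sum_right, fischer_smul_right,
      fischer_X_mul_left]
  have hclone : (optimalCloner d N s n hs).clone k ψ = (clonerWeight d N s n : ℂ) •
      ∑ m, ∑ r, Matrix.vecMulVec (A m r) (star (A m r)) := by
    ext x y
    rw [optimalCloner_clone, Matrix.smul_apply, smul_eq_mul]
    simp only [Matrix.sum_apply, Matrix.vecMulVec_apply, Pi.star_apply, A]
  rw [hclone, Matrix.smul_mulVec, dotProduct_smul, smul_eq_mul, Finset.sum_comm]
  simp only [Matrix.sum_mulVec, dotProduct_sum]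
  congr 1
  refine Finset.sum_congr rfl fun r _ => ?_
  rw [← sum_fischer_tensorMonomial_mul_star
    (annihilate_isHomogeneous ψ (clonerPolynomial_isHomogeneous hs ψ r))]
  refine Finset.sum_congr rfl fun m _ => ?_
  rw [← hA, Matrix.vecMulVec_mulVec, dotProduct_smul, Matrix.star_dotProduct (A m r) ψ]
  rfl

theorem overlap_optimalCloner [NeZero d] (hs : N + s = n + 1) (k : Fin (n + 1))
    {ψ : Fin d → ℂ} (hψ : IsPure ψ) :
    overlap ψ ((optimalCloner d N s n hs).clone k ψ) =
      (((n + 1 : ℕ) : ℝ) - N + N * ((n + 1 : ℕ) + d)) / ((n + 1 : ℕ) * (N + d)) := by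
  have hd : (d : ℝ) ≠ 0 := by exact_mod_cast NeZero.ne d
  have h0 : ((N + d).ascFactorial s : ℝ) ≠ 0 := by exact_mod_cast ascFactorial_add_ne_zero N s
  have h1 : (n.factorial : ℝ) ≠ 0 := by exact_mod_cast Nat.factorial_ne_zero _
  have h2 : (N.factorial : ℝ) ≠ 0 := by exact_mod_cast Nat.factorial_ne_zero _
  have hl : ∀ r : Fin s → Fin d, linearForm ψ * clonerPolynomial N ψ r =
      clonerPolynomial (N + 1) ψ r := fun r => by
    rw [clonerPolynomial, clonerPolynomial, pow_succ', mul_assoc]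
  have hsum : ∑ r : Fin s → Fin d, ((n.factorial : ℂ) * fischer
      (annihilate ψ (clonerPolynomial N ψ r)) (annihilate ψ (clonerPolynomial N ψ r))) =
      ((n.factorial * ((N + 1 + d).ascFactorial s * (N + 1).factorial -
        (N + d).ascFactorial s * N.factorial) : ℝ) : ℂ) := by
    simp only [fischer_annihilate_self hψ, hl, ← Finset.mul_sum, Finset.sum_sub_distrib,
      sum_fischer_clonerPolynomial hψ]
    push_cast
    ring
  have hasc : ((N : ℝ) + d) * (N + 1 + d).ascFactorial s =
      (n + 1 + d) * (N + d).ascFactorial s := by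
    have := Nat.succ_ascFactorial (N + d) s
    rw [show (N + d).succ = N + 1 + d by omega, show N + d + s = n + 1 + d by omega] at this
    exact_mod_cast this
  have hNd : (N : ℝ) + d ≠ 0 := by positivity
  have hasc' : ((N + 1 + d).ascFactorial s : ℝ) =
      (n + 1 + d) * (N + d).ascFactorial s / (N + d) := by
    rw [← hasc]
    field_simp
  rw [overlap, star_dotProduct_optimalCloner_clone hs, hsum, ← Complex.ofReal_mul,
    Complex.ofReal_re, clonerWeight, hasc', Nat.factorial_succ, Nat.factorial_succ]
  push_cast
  field_simp
  ring

theorem optimalCloner_isUniversal [NeZero d] (hs : N + s = n + 1) :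
    (optimalCloner d N s n hs).IsUniversal where
  same_clones ψ _ j k := by
    ext x y
    rw [optimalCloner_clone, optimalCloner_clone]
  state_independent ψ φ hψ hφ k := by
    rw [overlap_optimalCloner hs k hψ, overlap_optimalCloner hs k hφ]

end OptimalCloner

end PUFCloning
end

theorem theorem1 (d N M : ℕ) [NeZero d] (hM : 1 ≤ M) :
    (∀ R ∈ Matrix.unitaryGroup (Fin d) ℂ, ∀ L : PUFCloning.CloningMachine d N M,
      L.IsUniversal → ∀ k : Fin M,
        L.falseAccept R k = L.fidelity ∧
        L.falseAccept R k ≤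
          ((M : ℝ) - N + N * (M + d)) / (M * (N + d))) ∧
    (N ≤ M →
      IsGreatest {F : ℝ | ∃ L : PUFCloning.CloningMachine d N M, L.IsUniversal ∧ L.fidelity = F}
        (((M : ℝ) - N + N * (M + d)) / (M * (N + d)))) := by
  refine ⟨fun R hR L hL k => ?_, fun hNM => ⟨?_, ?_⟩⟩
  · obtain ⟨F, hF⟩ := hL.exists_const hM
    rw [PUFCloning.falseAccept_of_const hR hF k, PUFCloning.fidelity_of_const hM hF]
    exact ⟨rfl, PUFCloning.fidelity_le_of_const hM L hF⟩
  · obtain ⟨n, rfl⟩ : ∃ n, M = n + 1 := ⟨M - 1, by omega⟩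
    have hs : N + (n + 1 - N) = n + 1 := by omega
    exact ⟨PUFCloning.optimalCloner d N (n + 1 - N) n hs,
      PUFCloning.optimalCloner_isUniversal hs,
      PUFCloning.fidelity_of_const hM fun ψ hψ k => PUFCloning.overlap_optimalCloner hs k hψ⟩
  · rintro _ ⟨L, hL, rfl⟩
    obtain ⟨F, hF⟩ := hL.exists_const hM
    rw [PUFCloning.fidelity_of_const hM hF]
    exact PUFCloning.fidelity_le_of_const hM L hF
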